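/- Fix a real number $\sigma$ with $0<\sigma<\sqrt{\pi}$, write $w=\sigma+it$ for $t\in\mathbb{R}$, and let complex powers of $w$ be taken with the principal branch of the logarithm. For $z\in\mathbb{C}$ let $$R(z)=\int_{-\infty}^{\infty} w^{2z}\,\frac{e^{w^2}}{1-e^{w^2}}\,dt .$$ For every $\tau\in\mathbb{R}$, $$R(i\tau)=\int_{-\infty}^{\infty} w^{2i\tau}\,\frac{1}{e^{-w^2}-1}\,dt ,$$ where the integral converges absolutely. Moreover, the Lindelöf hypothesis, i.e. the statement that for every $\varepsilon>0$ $$\left|\zeta\left(\tfrac12+i\tau\right)\right|=O\left(|\tau|^{\varepsilon}\right)\qquad(|\tau|\to\infty),$$ is equivalent to the statement that for every $\varepsilon>0$ $$|R(i\tau)|=O\left(e^{\pi|\tau|/2}\,|\tau|^{\varepsilon}\right)\qquad(|\tau|\to\infty).$$ Here the implied constants may depend on $\varepsilon$ (and, in the second bound, on $\sigma$). -/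

import Mathlib

open Complex MeasureTheory Filter Asymptotics

noncomputable section

/-- The point `w = σ + i t` of the vertical line `Re w = σ`. -/
def vlinePt (σ t : ℝ) : ℂ := (σ : ℂ) + (t : ℂ) * I

/-- `R(z, α) = ∫ w^{2z} e^{α w²} / (1 - e^{w²}) dt` over `t ∈ ℝ`, with `w = σ + i t` and the
principal branch of the power; it is used for `0 < σ < √π`. -/
def genParabolicR (σ : ℝ) (z : ℂ) (α : ℝ) : ℂ :=
  ∫ t : ℝ, vlinePt σ t ^ (2 * z) *
    (Complex.exp ((α : ℂ) * vlinePt σ t ^ 2) / (1 - Complex.exp (vlinePt σ t ^ 2)))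

/-- The standard form `R(z) = R(z, 1)`. -/
def parabolicR (σ : ℝ) (z : ℂ) : ℂ := genParabolicR σ z 1

/-- The Lindelöf hypothesis: for every `ε > 0`, `|ζ(1/2 + i τ)| = O(|τ|^ε)` as `|τ| → ∞`. -/
def LindelofHypothesis : Prop :=
  ∀ ε : ℝ, 0 < ε →
    (fun τ : ℝ => ‖riemannZeta (1 / 2 + I * (τ : ℂ))‖) =O[cocompact ℝ] (fun τ : ℝ => |τ| ^ ε)

end

/-! For `Re z > 1` the contour `Re w = σ` can be pushed to the imaginary axis: no pole of the kernel
is crossed, and `w^{2z}` outweighs the double pole at `0`. There the integral is a Mellin transform,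
giving `R(z) = cos(πz) Γ(z + 1/2) ζ(z + 1/2)`. Since `R` is entire and the right side is analytic
off the real axis, the identity reaches `z = iτ` for `τ ≠ 0`.

The reflection formula gives `|Γ(1/2 + iτ)|² = π / cosh(πτ)`, hence `|R(iτ)|² = π cosh(πτ) |ζ(1/2 +
iτ)|²`. So `|R(iτ)|` has exact order `e^{π|τ|/2} |ζ(1/2 + iτ)|`, and the two bounds are equivalent
for each `ε` separately. -/

/-- The kernel `e^{w²} / (1 - e^{w²})`. -/
noncomputable def parabolicKernel (w : ℂ) : ℂ := Complex.exp (w ^ 2) / (1 - Complex.exp (w ^ 2))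

theorem parabolicR_eq_integral (σ : ℝ) (z : ℂ) :
    parabolicR σ z = ∫ t : ℝ, vlinePt σ t ^ (2 * z) * parabolicKernel (vlinePt σ t) := by
  simp [parabolicR, genParabolicR, parabolicKernel]

theorem vlinePt_re (σ t : ℝ) : (vlinePt σ t).re = σ := by simp [vlinePt]

theorem vlinePt_im (σ t : ℝ) : (vlinePt σ t).im = t := by simp [vlinePt]

theorem continuous_vlinePt (σ : ℝ) : Continuous (vlinePt σ) := by
  unfold vlinePt; fun_prop

theorem parabolicKernel_eq (w : ℂ) : parabolicKernel w = 1 / (Complex.exp (-(w ^ 2)) - 1) := by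
  rw [parabolicKernel, Complex.exp_neg]
  have h := Complex.exp_ne_zero (w ^ 2)
  rw [show (Complex.exp (w ^ 2))⁻¹ - 1 = (1 - Complex.exp (w ^ 2)) / Complex.exp (w ^ 2) by
    field_simp, one_div_div]

/-! ### Poles and decay of the kernel -/

/-- If `w² = 2πin` then `(Re w)² = (Im w)²` and `Re w · Im w = nπ`, so `(Re w)² = |n|π`; the bound
`√π` leaves only `n = 0`. -/
theorem exp_sq_ne_one {w : ℂ} (hw : w ≠ 0) (h0 : 0 ≤ w.re) (h1 : w.re < √Real.pi) :
    Complex.exp (w ^ 2) ≠ 1 := by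
  intro h
  obtain ⟨n, hn⟩ := Complex.exp_eq_one_iff.1 h
  have hre : w.re * w.re - w.im * w.im = 0 := by
    have := congrArg Complex.re hn
    simpa [pow_two] using this
  have him : w.re * w.im = n * Real.pi := by
    have := congrArg Complex.im hn
    simp [pow_two] at this
    linarith
  have hx : w.re * w.re < Real.pi := by
    have := Real.mul_self_sqrt Real.pi_pos.le
    nlinarith [Real.sqrt_nonneg Real.pi]
  have hpi := Real.pi_pos
  have hsq : (w.re * w.re) ^ 2 = (n : ℝ) ^ 2 * Real.pi ^ 2 := by
    have h2 : (w.re * w.im) ^ 2 = (n * Real.pi) ^ 2 := by rw [him]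
    have h3 : w.im * w.im = w.re * w.re := by linarith
    calc (w.re * w.re) ^ 2 = (w.re * w.re) * (w.im * w.im) := by rw [h3]; ring
      _ = (w.re * w.im) ^ 2 := by ring
      _ = _ := by rw [h2]; ring
  have hn1 : (n : ℝ) ^ 2 < 1 := by
    have : (w.re * w.re) ^ 2 < Real.pi ^ 2 := by
      have := mul_self_nonneg w.re
      gcongr
    rw [hsq] at this
    have hp2 : 0 < Real.pi ^ 2 := by positivity
    nlinarith
  have hn0 : n = 0 := by
    have : n ^ 2 < 1 := by exact_mod_cast hn1
    exact pow_eq_zero_iff two_ne_zero |>.1 (by linarith [sq_nonneg n])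
  subst hn0
  simp at hn
  exact hw hn

theorem norm_exp_vlinePt_sq (x t : ℝ) :
    ‖Complex.exp (vlinePt x t ^ 2)‖ = Real.exp (x ^ 2 - t ^ 2) := by
  rw [Complex.norm_exp]
  congr 1
  rw [pow_two, Complex.mul_re, vlinePt_re, vlinePt_im]; ring

/-- The weight `e^{A|log w|}` dominates `w^{2z}` for all `z` in a ball, and uniformity in `x` covers
the horizontal sides of the contour. -/
theorem exp_norm_log_mul_kernel_le {A σ x t : ℝ} (hA : 0 ≤ A) (hx0 : 0 ≤ x) (hx : x ≤ σ)
    (ht : σ + 1 ≤ |t|) :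
    Real.exp (A * ‖Complex.log (vlinePt x t)‖) * ‖parabolicKernel (vlinePt x t)‖ ≤
      2 * Real.exp (A * Real.pi + σ ^ 2 + 2 * A ^ 2) * Real.exp (-(1 / 2) * t ^ 2) := by
  have ht1 : 1 ≤ |t| := by linarith
  have ht2 : t ^ 2 = |t| ^ 2 := (sq_abs t).symm
  have hxx : x ^ 2 ≤ σ ^ 2 := by gcongr
  have hσt : σ ^ 2 - t ^ 2 ≤ -1 := by rw [ht2]; nlinarith
  have hE : ‖Complex.exp (vlinePt x t ^ 2)‖ ≤ Real.exp (σ ^ 2 - t ^ 2) := by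
    rw [norm_exp_vlinePt_sq]
    gcongr
  have hE2 : ‖Complex.exp (vlinePt x t ^ 2)‖ ≤ 1 / 2 := by
    have h1 : Real.exp (σ ^ 2 - t ^ 2) ≤ Real.exp (-1) := Real.exp_le_exp.2 hσt
    have h2 : Real.exp (-1) < 0.3678794412 := Real.exp_neg_one_lt_d9
    norm_num at h2 ⊢
    linarith
  have hden : 1 / 2 ≤ ‖1 - Complex.exp (vlinePt x t ^ 2)‖ := by
    have := norm_sub_norm_le (1 : ℂ) (Complex.exp (vlinePt x t ^ 2))
    rw [norm_one] at this
    linarith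
  have hK : ‖parabolicKernel (vlinePt x t)‖ ≤ 2 * Real.exp (σ ^ 2 - t ^ 2) := by
    rw [parabolicKernel, norm_div, div_le_iff₀ (by linarith)]
    nlinarith [Real.exp_pos (σ ^ 2 - t ^ 2)]
  have hw1 : |t| ≤ ‖vlinePt x t‖ := by
    have := Complex.abs_im_le_norm (vlinePt x t)
    rwa [vlinePt_im] at this
  have hw2 : ‖vlinePt x t‖ ≤ 2 * |t| := by
    have := Complex.norm_le_abs_re_add_abs_im (vlinePt x t)
    rw [vlinePt_re, vlinePt_im, abs_of_nonneg hx0] at this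
    linarith
  have hlog : ‖Complex.log (vlinePt x t)‖ ≤ 2 * |t| + Real.pi := by
    have h1 := Complex.norm_le_abs_re_add_abs_im (Complex.log (vlinePt x t))
    rw [Complex.log_re, Complex.log_im] at h1
    have h2 := Complex.abs_arg_le_pi (vlinePt x t)
    have h3 : 0 ≤ Real.log ‖vlinePt x t‖ := Real.log_nonneg (by linarith)
    rw [abs_of_nonneg h3] at h1
    have h4 := Real.log_le_sub_one_of_pos (show 0 < ‖vlinePt x t‖ by linarith)
    linarith
  calc Real.exp (A * ‖Complex.log (vlinePt x t)‖) * ‖parabolicKernel (vlinePt x t)‖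
      ≤ Real.exp (A * (2 * |t| + Real.pi)) * (2 * Real.exp (σ ^ 2 - t ^ 2)) := by gcongr
    _ = 2 * Real.exp (A * (2 * |t| + Real.pi) + (σ ^ 2 - t ^ 2)) := by rw [Real.exp_add]; ring
    _ ≤ 2 * Real.exp (A * Real.pi + σ ^ 2 + 2 * A ^ 2 + -(1 / 2) * t ^ 2) := by
        refine mul_le_mul_of_nonneg_left (Real.exp_le_exp.2 ?_) zero_le_two
        rw [ht2]
        -- This is `2A|t| ≤ t²/2 + 2A²`; half of the Gaussian decay pays for the power.
        nlinarith [sq_nonneg (|t| - 2 * A)]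
    _ = _ := by rw [Real.exp_add]; ring

theorem norm_cpow_le_exp_norm_log {w : ℂ} (hw : w ≠ 0) {z : ℂ} {A : ℝ} (hA : 2 * ‖z‖ ≤ A) :
    ‖w ^ (2 * z)‖ ≤ Real.exp (A * ‖Complex.log w‖) := by
  rw [Complex.cpow_def_of_ne_zero hw]
  refine (Complex.norm_exp_le_exp_norm _).trans (Real.exp_le_exp.2 ?_)
  rw [norm_mul, norm_mul, Complex.norm_ofNat, mul_comm]
  gcongr

/-! ### Integrability on the line and analyticity of `R` -/

theorem vlinePt_ne_zero_of_pos {σ : ℝ} (hσ : 0 < σ) (t : ℝ) : vlinePt σ t ≠ 0 := by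
  intro h
  have := vlinePt_re σ t
  rw [h] at this
  simp at this
  linarith

theorem continuous_log_vlinePt {σ : ℝ} (hσ : 0 < σ) :
    Continuous fun t => Complex.log (vlinePt σ t) :=
  (continuous_vlinePt σ).clog fun t => Or.inl (by rwa [vlinePt_re])

theorem continuous_kernel_vlinePt {σ : ℝ} (hσ : 0 < σ) (hσ₁ : σ < √Real.pi) :
    Continuous fun t => parabolicKernel (vlinePt σ t) := by
  unfold parabolicKernel
  have h := continuous_vlinePt σ
  refine Continuous.div (by fun_prop) (by fun_prop) fun t => ?_
  rw [sub_ne_zero]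
  exact (exp_sq_ne_one (vlinePt_ne_zero_of_pos hσ t) (by rw [vlinePt_re]; exact hσ.le)
    (by rwa [vlinePt_re])).symm

theorem continuous_cpow_vlinePt {σ : ℝ} (hσ : 0 < σ) (z : ℂ) :
    Continuous fun t => vlinePt σ t ^ (2 * z) :=
  (continuous_vlinePt σ).cpow continuous_const fun t => Or.inl (by rwa [vlinePt_re])

theorem integrable_of_norm_le_gaussian {E : Type*} [NormedAddCommGroup E] {h : ℝ → E}
    (hc : Continuous h) {C T : ℝ}
    (hb : ∀ t, T ≤ |t| → ‖h t‖ ≤ C * Real.exp (-(1 / 2) * t ^ 2)) : Integrable h := by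
  refine hc.locallyIntegrable.integrable_of_isBigO_cocompact
    (g := fun t => Real.exp (-(1 / 2) * t ^ 2)) (IsBigO.of_bound C ?_)
    ((integrable_exp_neg_mul_sq (by norm_num)).integrableAtFilter _)
  have := (tendsto_norm_cocompact_atTop (E := ℝ)).eventually (eventually_ge_atTop T)
  filter_upwards [this] with t ht
  rw [Real.norm_of_nonneg (Real.exp_pos _).le]
  exact hb t ht

theorem integrable_exp_norm_log_mul_kernel {σ : ℝ} (hσ : 0 < σ) (hσ₁ : σ < √Real.pi) {A : ℝ}
    (hA : 0 ≤ A) :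
    Integrable fun t : ℝ =>
      Real.exp (A * ‖Complex.log (vlinePt σ t)‖) * ‖parabolicKernel (vlinePt σ t)‖ := by
  have h1 := continuous_log_vlinePt hσ
  have h2 := continuous_kernel_vlinePt hσ hσ₁
  refine integrable_of_norm_le_gaussian (by fun_prop) (T := σ + 1)
    (C := 2 * Real.exp (A * Real.pi + σ ^ 2 + 2 * A ^ 2)) fun t ht => ?_
  rw [Real.norm_of_nonneg (by positivity)]
  exact exp_norm_log_mul_kernel_le hA hσ.le le_rfl ht

theorem integrable_cpow_mul_kernel {σ : ℝ} (hσ : 0 < σ) (hσ₁ : σ < √Real.pi) (z : ℂ) :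
    Integrable fun t : ℝ => vlinePt σ t ^ (2 * z) * parabolicKernel (vlinePt σ t) := by
  refine (integrable_exp_norm_log_mul_kernel hσ hσ₁ (A := 2 * ‖z‖) (by positivity)).mono'
    ((continuous_cpow_vlinePt hσ z).mul
      (continuous_kernel_vlinePt hσ hσ₁)).aestronglyMeasurable (ae_of_all _ fun t => ?_)
  rw [norm_mul]
  gcongr
  exact norm_cpow_le_exp_norm_log (vlinePt_ne_zero_of_pos hσ t) le_rfl

theorem differentiable_parabolicR {σ : ℝ} (hσ : 0 < σ) (hσ₁ : σ < √Real.pi) :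
    Differentiable ℂ (parabolicR σ) := by
  intro z₀
  have hlog := continuous_log_vlinePt hσ
  have hker := continuous_kernel_vlinePt hσ hσ₁
  have hcp := continuous_cpow_vlinePt hσ
  have key := hasDerivAt_integral_of_dominated_loc_of_deriv_le (μ := volume) (𝕜 := ℂ)
    (F := fun z (t : ℝ) => vlinePt σ t ^ (2 * z) * parabolicKernel (vlinePt σ t))
    (F' := fun z (t : ℝ) => vlinePt σ t ^ (2 * z) * Complex.log (vlinePt σ t) * 2 *
      parabolicKernel (vlinePt σ t))
    -- `2(‖z₀‖ + 1)` controls the power on the unit ball; the extra `2` absorbs the factor `2 log w`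
    -- from differentiation.
    (bound := fun t => Real.exp ((2 * (‖z₀‖ + 1) + 2) * ‖Complex.log (vlinePt σ t)‖) *
      ‖parabolicKernel (vlinePt σ t)‖) (x₀ := z₀)
    (Metric.ball_mem_nhds z₀ one_pos)
    (Eventually.of_forall fun z => ((hcp z).mul hker).aestronglyMeasurable)
    (integrable_cpow_mul_kernel hσ hσ₁ z₀)
    (((((hcp z₀).mul hlog).mul continuous_const).mul hker).aestronglyMeasurable)
    (ae_of_all _ fun t z hz => ?_)
    (integrable_exp_norm_log_mul_kernel hσ hσ₁ (by positivity))
    (ae_of_all _ fun t z _ => ?_)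
  · have := key.2.differentiableAt
    rwa [show parabolicR σ = _ from funext (parabolicR_eq_integral σ)]
  · have hz' : ‖z‖ ≤ ‖z₀‖ + 1 := by
      have := norm_le_norm_add_norm_sub' z z₀
      rw [Metric.mem_ball, dist_eq_norm] at hz
      linarith
    have h1 := norm_cpow_le_exp_norm_log (vlinePt_ne_zero_of_pos hσ t)
      (z := z) (A := 2 * (‖z₀‖ + 1)) (by linarith)
    have h2 : ‖Complex.log (vlinePt σ t)‖ * 2 ≤
        Real.exp (2 * ‖Complex.log (vlinePt σ t)‖) := by
      have := Real.add_one_le_exp (2 * ‖Complex.log (vlinePt σ t)‖)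
      linarith
    rw [norm_mul, mul_assoc (_ ^ _), norm_mul, norm_mul (Complex.log _), Complex.norm_ofNat,
      add_mul, Real.exp_add]
    gcongr
  · have := (((hasDerivAt_id z).const_mul (2 : ℂ)).const_cpow
      (Or.inl (vlinePt_ne_zero_of_pos hσ t))).mul_const (parabolicKernel (vlinePt σ t))
    simpa using this

/-! ### The integral over the imaginary axis -/

/-- Termwise Mellin transform of `1/(e^t - 1) = ∑ e^{-(n+1)t}`. -/
theorem mellin_one_div_exp_sub_one {s : ℂ} (hs : 1 < s.re) :
    mellin (fun t : ℝ => 1 / (Complex.exp t - 1)) s = Complex.Gamma s * riemannZeta s := by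
  have h := hasSum_mellin (ι := ℕ) (a := fun _ => 1) (p := fun n => (n : ℝ) + 1)
    (F := fun t : ℝ => 1 / (Complex.exp t - 1)) (s := s) (fun n => Or.inr (by positivity))
    (by linarith) (fun t ht => ?_) ?_
  · rw [← h.tsum_eq, zeta_eq_tsum_one_div_nat_add_one_cpow hs, ← tsum_mul_left]
    push_cast
    simp_rw [mul_div_assoc]
  · rw [Set.mem_Ioi] at ht
    have h1 : ‖((Real.exp (-t) : ℝ) : ℂ)‖ < 1 := by
      rw [Complex.norm_real, Real.norm_of_nonneg (Real.exp_pos _).le]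
      rw [← Real.exp_zero]
      exact Real.exp_lt_exp.2 (by linarith)
    convert! (hasSum_geometric_of_norm_lt_one h1).mul_left ((Real.exp (-t) : ℝ) : ℂ) using 1
    · ext n
      rw [← pow_succ', one_mul, ← Complex.ofReal_pow, ← Real.exp_nat_mul]
      push_cast
      ring_nf
    · rw [Complex.ofReal_exp, Complex.ofReal_neg, Complex.exp_neg]
      have h0 := Complex.exp_ne_zero (t : ℂ)
      rw [← mul_inv, mul_sub, mul_inv_cancel₀ h0, mul_one, one_div]
  · have := (summable_nat_add_iff 1).2 (Real.summable_one_div_nat_rpow.2 hs)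
    simpa using this

/-- The argument is `±π/2` on the two half-axes; the resulting phases `e^{±iπz}` add up to `2
cos(πz)`. -/
theorem vlinePt_zero_cpow_of_pos {t : ℝ} (ht : 0 < t) (z : ℂ) :
    vlinePt 0 t ^ (2 * z) = Complex.exp (I * Real.pi * z) * (t : ℂ) ^ (2 * z) := by
  have h0 : (t : ℂ) ≠ 0 := by exact_mod_cast ht.ne'
  rw [show vlinePt 0 t = (t : ℂ) * I by simp [vlinePt],
    Complex.cpow_def_of_ne_zero (mul_ne_zero h0 I_ne_zero), Complex.cpow_def_of_ne_zero h0,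
    Complex.log_ofReal_mul ht I_ne_zero, Complex.log_I, ← Complex.exp_add,
    Complex.ofReal_log ht.le]
  ring_nf

theorem vlinePt_zero_neg_cpow_of_pos {t : ℝ} (ht : 0 < t) (z : ℂ) :
    vlinePt 0 (-t) ^ (2 * z) = Complex.exp (-(I * Real.pi * z)) * (t : ℂ) ^ (2 * z) := by
  have h0 : (t : ℂ) ≠ 0 := by exact_mod_cast ht.ne'
  rw [show vlinePt 0 (-t) = (t : ℂ) * -I by simp [vlinePt],
    Complex.cpow_def_of_ne_zero (mul_ne_zero h0 (neg_ne_zero.2 I_ne_zero)),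
    Complex.cpow_def_of_ne_zero h0,
    Complex.log_ofReal_mul ht (neg_ne_zero.2 I_ne_zero), Complex.log_neg_I, ← Complex.exp_add,
    Complex.ofReal_log ht.le]
  ring_nf

theorem parabolicKernel_vlinePt_zero (t : ℝ) :
    parabolicKernel (vlinePt 0 t) = 1 / (Complex.exp ((t ^ (2 : ℝ) : ℝ) : ℂ) - 1) := by
  rw [parabolicKernel_eq]
  congr 3
  simp [vlinePt, mul_pow]

theorem integral_Ioi_cpow_mul_kernel {z : ℂ} (hz : 1 / 2 < z.re) :
    ∫ t in Set.Ioi (0 : ℝ), (t : ℂ) ^ (2 * z) * (1 / (Complex.exp ((t ^ (2 : ℝ) : ℝ) : ℂ) - 1)) =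
      1 / 2 * (Complex.Gamma (z + 1 / 2) * riemannZeta (z + 1 / 2)) := by
  have h := mellin_comp_rpow (fun t : ℝ => 1 / (Complex.exp t - 1)) (2 * z + 1) 2
  have e : (2 * z + 1) / ((2 : ℝ) : ℂ) = z + 1 / 2 := by push_cast; ring
  rw [e, mellin_one_div_exp_sub_one (by simp; linarith), mellin] at h
  simp only [add_sub_cancel_right, smul_eq_mul] at h
  rw [h]
  simp [Complex.real_smul]

theorem integral_vlinePt_zero {z : ℂ} (hz : 1 / 2 < z.re)
    (hint : Integrable fun t : ℝ => vlinePt 0 t ^ (2 * z) * parabolicKernel (vlinePt 0 t)) :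
    ∫ t : ℝ, vlinePt 0 t ^ (2 * z) * parabolicKernel (vlinePt 0 t) =
      Complex.cos (Real.pi * z) * (Complex.Gamma (z + 1 / 2) * riemannZeta (z + 1 / 2)) := by
  rw [← intervalIntegral.integral_Iic_add_Ioi (b := 0) hint.integrableOn hint.integrableOn]
  have h1 := integral_comp_neg_Ioi 0
    fun t : ℝ => vlinePt 0 t ^ (2 * z) * parabolicKernel (vlinePt 0 t)
  rw [neg_zero] at h1
  have hneg : ∀ t ∈ Set.Ioi (0 : ℝ),
      vlinePt 0 (-t) ^ (2 * z) * parabolicKernel (vlinePt 0 (-t)) =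
      Complex.exp (-(I * Real.pi * z)) *
        ((t : ℂ) ^ (2 * z) * (1 / (Complex.exp ((t ^ (2 : ℝ) : ℝ) : ℂ) - 1))) := fun t ht => by
    rw [vlinePt_zero_neg_cpow_of_pos ht, parabolicKernel_vlinePt_zero, mul_assoc, Real.rpow_two,
      Real.rpow_two, neg_sq]
  have hpos : ∀ t ∈ Set.Ioi (0 : ℝ),
      vlinePt 0 t ^ (2 * z) * parabolicKernel (vlinePt 0 t) =
      Complex.exp (I * Real.pi * z) *
        ((t : ℂ) ^ (2 * z) * (1 / (Complex.exp ((t ^ (2 : ℝ) : ℝ) : ℂ) - 1))) := fun t ht => by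
    rw [vlinePt_zero_cpow_of_pos ht, parabolicKernel_vlinePt_zero, mul_assoc]
  rw [← h1, setIntegral_congr_fun measurableSet_Ioi hneg,
    setIntegral_congr_fun measurableSet_Ioi hpos, integral_const_mul, integral_const_mul,
    integral_Ioi_cpow_mul_kernel hz, Complex.cos]
  ring_nf

/-! ### Shifting the contour -/

/-- Writing `e^u - 1 = u · dslope exp 0 u` with `u = w²` cancels the double pole and leaves
`w^{2z-2}`, continuous at `0` because `Re z > 1`. -/
theorem continuousOn_cpow_mul_kernel {z : ℂ} (hz : 1 < z.re) :
    ContinuousOn (fun w : ℂ => w ^ (2 * z) * parabolicKernel w)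
      {w | 0 ≤ w.re ∧ w.re < √Real.pi} := by
  have hd : Continuous (dslope Complex.exp 0) := by
    rw [← continuousOn_univ, continuousOn_dslope univ_mem]
    exact ⟨Complex.continuous_exp.continuousOn, Complex.differentiable_exp _⟩
  have hz0 : z ≠ 0 := by rintro rfl; simp at hz; linarith
  have hz2 : 2 * z - 2 ≠ 0 := by
    intro h
    have := congrArg Complex.re h
    simp at this
    linarith
  have hcont : ContinuousOn (fun w : ℂ => -(w ^ (2 * z - 2) * Complex.exp (w ^ 2)) /
      dslope Complex.exp 0 (w ^ 2)) {w | 0 ≤ w.re ∧ w.re < √Real.pi} := by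
    refine ContinuousOn.div (ContinuousOn.neg (ContinuousOn.mul ?_ (by fun_prop)))
      (by fun_prop) ?_
    · intro w hw
      refine ContinuousAt.continuousWithinAt ?_
      by_cases h : w = 0
      · subst h
        have h3 : 0 < (2 * z - 2).re := by simp; linarith
        exact (Complex.continuousAt_cpow_zero_of_re_pos h3).comp (f := fun x : ℂ => (x, 2 * z - 2))
          (by fun_prop)
      · refine continuousAt_cpow_const ?_
        rw [Complex.mem_slitPlane_iff]
        rcases hw.1.lt_or_eq with h' | h'
        · exact Or.inl h'
        · exact Or.inr fun h'' => h (Complex.ext h'.symm h'')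
    · intro w hw
      by_cases h : w = 0
      · simp [h]
      · have h2 : w ^ 2 ≠ 0 := pow_ne_zero 2 h
        rw [dslope_of_ne _ h2, slope_def_field]
        refine div_ne_zero ?_ (by simpa using h)
        rw [Complex.exp_zero, sub_ne_zero]
        exact exp_sq_ne_one h hw.1 hw.2
  refine hcont.congr fun w hw => ?_
  by_cases h : w = 0
  · subst h
    simp [hz0, hz2]
  · have h2 : w ^ 2 ≠ 0 := pow_ne_zero 2 h
    have h3 : Complex.exp (w ^ 2) - 1 ≠ 0 := sub_ne_zero.2 (exp_sq_ne_one h hw.1 hw.2)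
    have h4 : 1 - Complex.exp (w ^ 2) ≠ 0 := by rwa [← neg_sub, neg_ne_zero] at h3
    have h5 : (w : ℂ) ^ (2 * z) = w ^ (2 * z - 2) * w ^ 2 := by
      rw [Complex.cpow_sub _ _ h, show w ^ (2 : ℂ) = w ^ 2 from Complex.cpow_ofNat w 2]
      field_simp
    simp only
    rw [dslope_of_ne _ h2, slope_def_field, Complex.exp_zero, parabolicKernel, sub_zero, h5]
    field_simp
    ring

theorem differentiableAt_cpow_mul_kernel (z : ℂ) {w : ℂ} (h0 : 0 < w.re) (h1 : w.re < √Real.pi) :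
    DifferentiableAt ℂ (fun w : ℂ => w ^ (2 * z) * parabolicKernel w) w := by
  have hw : w ≠ 0 := by rintro rfl; simp at h0
  have h2 : 1 - Complex.exp (w ^ 2) ≠ 0 := sub_ne_zero.2 (exp_sq_ne_one hw h0.le h1).symm
  unfold parabolicKernel
  refine DifferentiableAt.mul (differentiableAt_id.cpow_const (Or.inl h0)) ?_
  exact DifferentiableAt.div (by fun_prop) (by fun_prop) h2

theorem norm_cpow_mul_kernel_le {σ x t : ℝ} (z : ℂ) (hx0 : 0 ≤ x) (hx : x ≤ σ)
    (ht : σ + 1 ≤ |t|) :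
    ‖vlinePt x t ^ (2 * z) * parabolicKernel (vlinePt x t)‖ ≤
      2 * Real.exp (2 * ‖z‖ * Real.pi + σ ^ 2 + 2 * (2 * ‖z‖) ^ 2) *
        Real.exp (-(1 / 2) * t ^ 2) := by
  refine le_trans ?_ (exp_norm_log_mul_kernel_le (A := 2 * ‖z‖) (by positivity) hx0 hx ht)
  rw [norm_mul]
  gcongr
  refine norm_cpow_le_exp_norm_log (fun h => ?_) le_rfl
  have := vlinePt_im x t
  rw [h, Complex.zero_im] at this
  rw [← this, abs_zero] at ht
  linarith

theorem integrable_vlinePt_zero {z : ℂ} (hz : 1 < z.re) :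
    Integrable fun t : ℝ => vlinePt 0 t ^ (2 * z) * parabolicKernel (vlinePt 0 t) := by
  refine integrable_of_norm_le_gaussian ?_ (T := 0 + 1)
    (fun t ht => norm_cpow_mul_kernel_le z le_rfl le_rfl ht)
  refine (continuousOn_cpow_mul_kernel hz).comp_continuous (continuous_vlinePt 0) fun t => ?_
  exact ⟨(vlinePt_re 0 t).ge, by rw [vlinePt_re]; positivity⟩

theorem tendsto_horizontal_integral (σ : ℝ) (hσ : 0 < σ) (z : ℂ) {l : Filter ℝ}
    (hl : Tendsto (fun T : ℝ => |T|) l atTop) :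
    Tendsto (fun T : ℝ => ∫ x in (0 : ℝ)..σ, vlinePt x T ^ (2 * z) * parabolicKernel (vlinePt x T))
      l (nhds 0) := by
  have hg : Tendsto (fun T : ℝ => 2 * Real.exp (2 * ‖z‖ * Real.pi + σ ^ 2 + 2 * (2 * ‖z‖) ^ 2) *
        Real.exp (-(1 / 2) * T ^ 2) * |σ - 0|) l (nhds 0) := by
    have h1 : Tendsto (fun T : ℝ => Real.exp (-(1 / 2) * T ^ 2)) l (nhds 0) := by
      refine Real.tendsto_exp_atBot.comp ?_
      have := ((tendsto_pow_atTop two_ne_zero).comp hl).const_mul_atTop_of_neg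
        (show -(1 / 2 : ℝ) < 0 by norm_num)
      simpa [Function.comp_def, sq_abs] using this
    simpa using (h1.const_mul
      (2 * Real.exp (2 * ‖z‖ * Real.pi + σ ^ 2 + 2 * (2 * ‖z‖) ^ 2))).mul_const |σ - 0|
  refine squeeze_zero_norm' ?_ hg
  filter_upwards [hl.eventually (eventually_ge_atTop (σ + 1))] with T hT
  refine intervalIntegral.norm_integral_le_of_norm_le_const fun x hx => ?_
  rw [Set.uIoc_of_le hσ.le] at hx
  exact norm_cpow_mul_kernel_le z hx.1.le hx.2 hT

theorem parabolicR_eq_integral_vlinePt_zero {σ : ℝ} (hσ : 0 < σ) (hσ₁ : σ < √Real.pi) {z : ℂ}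
    (hz : 1 < z.re) :
    parabolicR σ z = ∫ t : ℝ, vlinePt 0 t ^ (2 * z) * parabolicKernel (vlinePt 0 t) := by
  have hrect : ∀ T : ℝ,
      (∫ x in (0 : ℝ)..σ, vlinePt x (-T) ^ (2 * z) * parabolicKernel (vlinePt x (-T))) -
      (∫ x in (0 : ℝ)..σ, vlinePt x T ^ (2 * z) * parabolicKernel (vlinePt x T)) +
      I * (∫ t in (-T)..T, vlinePt σ t ^ (2 * z) * parabolicKernel (vlinePt σ t)) -
      I * (∫ t in (-T)..T, vlinePt 0 t ^ (2 * z) * parabolicKernel (vlinePt 0 t)) = 0 := by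
    intro T
    have h := Complex.integral_boundary_rect_eq_zero_of_continuousOn_of_differentiableOn
      (fun w : ℂ => w ^ (2 * z) * parabolicKernel w) (vlinePt 0 (-T)) (vlinePt σ T)
      ((continuousOn_cpow_mul_kernel hz).mono fun w hw => ?_)
      (fun w hw => (differentiableAt_cpow_mul_kernel z ?_ ?_).differentiableWithinAt)
    · rw [vlinePt_re, vlinePt_re, vlinePt_im, vlinePt_im] at h
      exact h
    · have := hw.1
      rw [vlinePt_re, vlinePt_re, Set.uIcc_of_le hσ.le] at this
      exact ⟨this.1, this.2.trans_lt hσ₁⟩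
    · have := hw.1
      rw [vlinePt_re, vlinePt_re, min_eq_left hσ.le] at this
      exact this.1
    · have := hw.1
      rw [vlinePt_re, vlinePt_re, max_eq_right hσ.le] at this
      exact this.2.trans hσ₁
  -- The lower side has height `-T`, hence the filter `atTop.map Neg.neg`.
  have hlim := (((tendsto_horizontal_integral σ hσ z (l := atTop.map Neg.neg) ?_).comp
    tendsto_map).sub (tendsto_horizontal_integral σ hσ z tendsto_abs_atTop_atTop)).add
    ((intervalIntegral_tendsto_integral (integrable_cpow_mul_kernel hσ hσ₁ z)
      tendsto_neg_atTop_atBot tendsto_id).const_mul I) |>.sub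
    ((intervalIntegral_tendsto_integral (integrable_vlinePt_zero hz)
      tendsto_neg_atTop_atBot tendsto_id).const_mul I)
  · have h0 := tendsto_nhds_unique (hlim.congr hrect) tendsto_const_nhds
    rw [sub_zero, zero_add, ← mul_sub, mul_eq_zero, or_iff_right I_ne_zero, sub_eq_zero] at h0
    rw [parabolicR_eq_integral, h0]
  · rw [tendsto_map'_iff]
    simpa [Function.comp_def] using tendsto_abs_atTop_atTop (G := ℝ)

theorem parabolicR_eq_of_one_lt_re {σ : ℝ} (hσ : 0 < σ) (hσ₁ : σ < √Real.pi) {z : ℂ}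
    (hz : 1 < z.re) :
    parabolicR σ z =
      Complex.cos (Real.pi * z) * (Complex.Gamma (z + 1 / 2) * riemannZeta (z + 1 / 2)) := by
  rw [parabolicR_eq_integral_vlinePt_zero hσ hσ₁ hz,
    integral_vlinePt_zero (by linarith) (integrable_vlinePt_zero hz)]

/-! ### Analytic continuation off the real axis -/

theorem differentiableAt_cos_mul_Gamma_mul_zeta {z : ℂ} (hz : z.im ≠ 0) :
    DifferentiableAt ℂ (fun z : ℂ =>
      Complex.cos (Real.pi * z) * (Complex.Gamma (z + 1 / 2) * riemannZeta (z + 1 / 2))) z := by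
  have hG : DifferentiableAt ℂ Complex.Gamma (z + 1 / 2) := by
    refine Complex.differentiableAt_Gamma _ fun m hm => hz ?_
    simpa using congrArg Complex.im hm
  have hZ : DifferentiableAt ℂ riemannZeta (z + 1 / 2) := by
    refine differentiableAt_riemannZeta fun hm => hz ?_
    simpa using congrArg Complex.im hm
  refine DifferentiableAt.mul (by fun_prop) (DifferentiableAt.mul ?_ ?_)
  · exact hG.comp z (by fun_prop)
  · exact hZ.comp z (by fun_prop)

/-- Identity theorem, to be applied in each open half-plane: the poles of `Γ` and `ζ` are real, and
both half-planes meet `Re z > 1`. -/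
theorem parabolicR_eq_of_mem_convex {σ : ℝ} (hσ : 0 < σ) (hσ₁ : σ < √Real.pi) {U : Set ℂ}
    (hU : IsOpen U) (hconv : Convex ℝ U) (him : ∀ z ∈ U, z.im ≠ 0) {z₀ : ℂ} (h₀ : z₀ ∈ U)
    (h₁ : 1 < z₀.re) {z : ℂ} (hz : z ∈ U) :
    parabolicR σ z =
      Complex.cos (Real.pi * z) * (Complex.Gamma (z + 1 / 2) * riemannZeta (z + 1 / 2)) := by
  refine AnalyticOnNhd.eqOn_of_preconnected_of_eventuallyEq
    ((differentiable_parabolicR hσ hσ₁).differentiableOn.analyticOnNhd hU)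
    (DifferentiableOn.analyticOnNhd (fun w hw =>
      (differentiableAt_cos_mul_Gamma_mul_zeta (him w hw)).differentiableWithinAt) hU)
    hconv.isPreconnected h₀ ?_ hz
  filter_upwards [(isOpen_lt continuous_const Complex.continuous_re).mem_nhds h₁] with w hw
  exact parabolicR_eq_of_one_lt_re hσ hσ₁ hw

theorem parabolicR_eq {σ : ℝ} (hσ : 0 < σ) (hσ₁ : σ < √Real.pi) {z : ℂ} (hz : z.im ≠ 0) :
    parabolicR σ z =
      Complex.cos (Real.pi * z) * (Complex.Gamma (z + 1 / 2) * riemannZeta (z + 1 / 2)) := by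
  rcases hz.lt_or_gt with h | h
  · exact parabolicR_eq_of_mem_convex hσ hσ₁ (U := {w : ℂ | w.im < 0})
      (isOpen_lt Complex.continuous_im continuous_const) (convex_halfSpace_im_lt 0)
      (fun w hw => ne_of_lt hw) (z₀ := ⟨2, -1⟩) (by simp) (by simp) h
  · exact parabolicR_eq_of_mem_convex hσ hσ₁ (U := {w : ℂ | 0 < w.im})
      (isOpen_lt continuous_const Complex.continuous_im) (convex_halfSpace_im_gt 0)
      (fun w hw => ne_of_gt hw) (z₀ := ⟨2, 1⟩) (by simp) (by simp) h

/-! ### Size on the critical line -/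

/-- On the critical line `1 - s` is the conjugate of `s`, so the reflection formula computes
`|Γ(s)|²`. -/
theorem norm_Gamma_half_add_sq (τ : ℝ) :
    ‖Complex.Gamma (1 / 2 + I * τ)‖ ^ 2 = Real.pi / Real.cosh (Real.pi * τ) := by
  have h := Complex.Gamma_mul_Gamma_one_sub (1 / 2 + I * τ)
  have hc : (1 : ℂ) - (1 / 2 + I * τ) = (starRingEnd ℂ) (1 / 2 + I * τ) := by
    apply Complex.ext <;> norm_num
  rw [hc, Complex.Gamma_conj, Complex.mul_conj, Complex.normSq_eq_norm_sq,
    show (Real.pi : ℂ) * (1 / 2 + I * τ) = (Real.pi * τ : ℝ) * I + Real.pi / 2 by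
      push_cast; ring, Complex.sin_add_pi_div_two, Complex.cos_mul_I] at h
  exact_mod_cast h

theorem norm_parabolicR_I_mul_sq {σ : ℝ} (hσ : 0 < σ) (hσ₁ : σ < √Real.pi) {τ : ℝ} (hτ : τ ≠ 0) :
    ‖parabolicR σ (I * τ)‖ ^ 2 =
      Real.pi * Real.cosh (Real.pi * τ) * ‖riemannZeta (1 / 2 + I * τ)‖ ^ 2 := by
  have hcosh := Real.cosh_pos (Real.pi * τ)
  rw [parabolicR_eq hσ hσ₁ (by simpa using hτ), norm_mul, norm_mul, mul_pow, mul_pow,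
    add_comm (I * (τ : ℂ)), norm_Gamma_half_add_sq,
    show (Real.pi : ℂ) * (I * τ) = (Real.pi * τ : ℝ) * I by push_cast; ring,
    Complex.cos_mul_I, ← Complex.ofReal_cosh, Complex.norm_real, Real.norm_of_nonneg hcosh.le]
  field_simp

theorem isTheta_parabolicR {σ : ℝ} (hσ : 0 < σ) (hσ₁ : σ < √Real.pi) :
    (fun τ : ℝ => ‖parabolicR σ (I * (τ : ℂ))‖) =Θ[cocompact ℝ]
      fun τ : ℝ => Real.exp (Real.pi * |τ| / 2) * ‖riemannZeta (1 / 2 + I * (τ : ℂ))‖ := by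
  have hpi := Real.pi_pos
  have hev : ∀ᶠ τ : ℝ in cocompact ℝ, τ ≠ 0 := by
    filter_upwards [(isCompact_singleton (x := (0 : ℝ))).compl_mem_cocompact] with τ hτ using hτ
  have hexp : ∀ τ : ℝ, Real.exp (Real.pi * |τ| / 2) ^ 2 = Real.exp |Real.pi * τ| := fun τ => by
    rw [← Real.exp_nat_mul, abs_mul, abs_of_pos hpi]
    push_cast
    ring_nf
  -- From `e^{|x|}/2 ≤ cosh x ≤ e^{|x|}`; the constant `1` suffices below because `π/2 ≥ 1`.
  refine ⟨IsBigO.of_bound (√Real.pi) ?_, IsBigO.of_bound 1 ?_⟩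
  · filter_upwards [hev] with τ hτ
    rw [norm_norm, Real.norm_of_nonneg (by positivity)]
    refine abs_le_of_sq_le_sq' ?_ (by positivity) |>.2
    rw [norm_parabolicR_I_mul_sq hσ hσ₁ hτ, mul_pow, mul_pow, Real.sq_sqrt hpi.le, hexp, mul_assoc]
    gcongr
    rw [← Real.cosh_abs, Real.cosh_eq]
    have : Real.exp (-|Real.pi * τ|) ≤ Real.exp |Real.pi * τ| :=
      Real.exp_le_exp.2 (by linarith [abs_nonneg (Real.pi * τ)])
    linarith
  · filter_upwards [hev] with τ hτ
    rw [norm_norm, Real.norm_of_nonneg (by positivity), one_mul]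
    refine abs_le_of_sq_le_sq' ?_ (by positivity) |>.2
    rw [norm_parabolicR_I_mul_sq hσ hσ₁ hτ, mul_pow, hexp]
    gcongr
    rw [← Real.cosh_abs, Real.cosh_eq]
    have h1 := Real.exp_pos (-|Real.pi * τ|)
    have h2 := Real.exp_pos (|Real.pi * τ|)
    nlinarith [Real.pi_gt_three]

theorem isBigO_exp_mul_iff {f g : ℝ → ℝ} :
    (fun τ : ℝ => Real.exp (Real.pi * |τ| / 2) * f τ) =O[cocompact ℝ]
      (fun τ : ℝ => Real.exp (Real.pi * |τ| / 2) * g τ) ↔ f =O[cocompact ℝ] g := by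
  constructor
  · intro h
    have := (isBigO_refl (fun τ : ℝ => Real.exp (-(Real.pi * |τ| / 2))) (cocompact ℝ)).mul h
    simpa only [← mul_assoc, ← Real.exp_add, neg_add_cancel, Real.exp_zero, one_mul] using this
  · exact fun h => (isBigO_refl _ _).mul h

theorem mainTheorem5 (σ : ℝ) (hσ₀ : 0 < σ) (hσ₁ : σ < Real.sqrt Real.pi) :
    (∀ τ : ℝ,
      Integrable (fun t : ℝ => vlinePt σ t ^ (2 * (I * (τ : ℂ))) *
        (1 / (Complex.exp (-(vlinePt σ t ^ 2)) - 1))) volume ∧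
      parabolicR σ (I * (τ : ℂ)) =
        ∫ t : ℝ, vlinePt σ t ^ (2 * (I * (τ : ℂ))) *
          (1 / (Complex.exp (-(vlinePt σ t ^ 2)) - 1))) ∧
    (LindelofHypothesis ↔
      ∀ ε : ℝ, 0 < ε →
        (fun τ : ℝ => ‖parabolicR σ (I * (τ : ℂ))‖) =O[cocompact ℝ]
          (fun τ : ℝ => Real.exp (Real.pi * |τ| / 2) * |τ| ^ ε)) := by
  refine ⟨fun τ => ?_, forall₂_congr fun ε _ => ?_⟩
  · simp_rw [← parabolicKernel_eq]
    exact ⟨integrable_cpow_mul_kernel hσ₀ hσ₁ _, parabolicR_eq_integral σ _⟩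
  · rw [(isTheta_parabolicR hσ₀ hσ₁).isBigO_congr_left, isBigO_exp_mul_iff]
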